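/- Let $N\ge 2$, let $\mathbb K=\mathbb R$ or $\mathbb C$, let $X=\ell^p(\mathbb N)$ with $1\le p<\infty$ or $X=c_0(\mathbb N)$ over $\mathbb K$, and let $B$ be the backward shift $(x_1,x_2,x_3,\dots)\mapsto(x_2,x_3,\dots)$ on $X$. Let $\lambda_1,\dots,\lambda_N\in\mathbb K$ with $1<|\lambda_1|\le\dots\le|\lambda_N|$, let $i_1,\dots,i_N\ge 1$ be integers, and put $T_s=\lambda_sB^{i_s}$ for $1\le s\le N$. For a family $\mathcal A$ of subsets of $\mathbb N$, the operators $T_1,\dots,T_N$ are called disjoint $\mathcal A$-hypercyclic if there is $x\in X$ such that $\{n : (T_1^nx,\dots,T_N^nx)\in U\}\in\mathcal A$ for every non-empty open set $U\subseteq X^N$. They are called disjoint hypercyclic, disjoint reiteratively hypercyclic, disjoint upper frequently hypercyclic, or disjoint frequently hypercyclic when $\mathcal A$ is, respectively, the family of infinite sets, of sets of positive upper Banach density $\limsup_{M\to\infty}\max_{k\ge1}\frac{1}{M}\operatorname{card}(A\cap[k+1,k+M])$, of sets of positive upper density $\limsup_{M\to\infty}\frac1M\operatorname{card}\{n\le M:n\in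 A\}$, or of sets of positive lower density $\liminf_{M\to\infty}\frac1M\operatorname{card}\{n\le M:n\in A\}$. Then the following assertions are equivalent: 1. $T_1,\dots,T_N$ are disjoint frequently hypercyclic on $X$; 2. $T_1,\dots,T_N$ are disjoint upper frequently hypercyclic on $X$; 3. $T_1,\dots,T_N$ are disjoint reiteratively hypercyclic on $X$; 4. $T_1,\dots,T_N$ are disjoint hypercyclic on $X$; 5. for every $1\le s<t\le N$, $i_s<i_t$ and $|\lambda_s|<|\lambda_t|$. -/

import Mathlib

open Filter Set
open scoped ENNReal ZeroAtInfty

noncomputable section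

/-- Lower density `liminf_N card {n ≤ N : n ∈ A} / N`, with values in `[0, ∞]`. -/
def lowerDensity (A : Set ℕ) : ℝ≥0∞ :=
  liminf (fun N : ℕ => (({n ∈ A | n ≤ N}.ncard : ℕ) : ℝ≥0∞) / (N : ℝ≥0∞)) atTop

/-- Upper density `limsup_N card {n ≤ N : n ∈ A} / N`, with values in `[0, ∞]`. -/
def upperDensity (A : Set ℕ) : ℝ≥0∞ :=
  limsup (fun N : ℕ => (({n ∈ A | n ≤ N}.ncard : ℕ) : ℝ≥0∞) / (N : ℝ≥0∞)) atTop

/-- Upper Banach density `limsup_N max_{k ≥ 1} card (A ∩ [k + 1, k + N]) / N`,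
with values in `[0, ∞]`. -/
def upperBanachDensity (A : Set ℕ) : ℝ≥0∞ :=
  limsup (fun N : ℕ => ⨆ k : ℕ, ⨆ _ : 1 ≤ k,
    (((A ∩ Icc (k + 1) (k + N)).ncard : ℕ) : ℝ≥0∞) / (N : ℝ≥0∞)) atTop

/-- The family of infinite subsets of `ℕ`. -/
def infiniteSets : Set (Set ℕ) := {A | A.Infinite}

/-- The family of sets of positive upper Banach density. -/
def posUpperBanachDensitySets : Set (Set ℕ) := {A | 0 < upperBanachDensity A}

/-- The family of sets of positive upper density. -/
def posUpperDensitySets : Set (Set ℕ) := {A | 0 < upperDensity A}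

/-- The family of sets of positive lower density. -/
def posLowerDensitySets : Set (Set ℕ) := {A | 0 < lowerDensity A}

section Hypercyclicity

variable {𝕜 : Type*} [RCLike 𝕜] {X : Type*} [NormedAddCommGroup X] [NormedSpace 𝕜 X]

/-- `x` is an `𝒜`-hypercyclic vector for `T`: every non-empty open set is visited by the orbit
of `x` along a set of times belonging to `𝒜`. -/
def IsHypercyclicVectorFor (𝒜 : Set (Set ℕ)) (T : X →L[𝕜] X) (x : X) : Prop :=
  ∀ U : Set X, IsOpen U → U.Nonempty → {n : ℕ | (T ^ n) x ∈ U} ∈ 𝒜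

/-- The operators `T_1, …, T_N` are disjoint `𝒜`-hypercyclic: the direct sum
`T_1 ⊕ ⋯ ⊕ T_N` on `X^N` has an `𝒜`-hypercyclic vector on the diagonal. -/
def DisjointHypercyclicFor (𝒜 : Set (Set ℕ)) {N : ℕ} (T : Fin N → X →L[𝕜] X) : Prop :=
  ∃ x : X, IsHypercyclicVectorFor 𝒜 (ContinuousLinearMap.piMap (R := 𝕜) T) (fun _ : Fin N => x)

/-- Disjoint hypercyclicity. -/
def DisjointHypercyclic {N : ℕ} (T : Fin N → X →L[𝕜] X) : Prop :=
  DisjointHypercyclicFor infiniteSets T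

/-- Disjoint reiterative hypercyclicity. -/
def DisjointReiterativelyHypercyclic {N : ℕ} (T : Fin N → X →L[𝕜] X) : Prop :=
  DisjointHypercyclicFor posUpperBanachDensitySets T

/-- Disjoint upper frequent hypercyclicity. -/
def DisjointUpperFrequentlyHypercyclic {N : ℕ} (T : Fin N → X →L[𝕜] X) : Prop :=
  DisjointHypercyclicFor posUpperDensitySets T

/-- Disjoint frequent hypercyclicity. -/
def DisjointFrequentlyHypercyclic {N : ℕ} (T : Fin N → X →L[𝕜] X) : Prop :=
  DisjointHypercyclicFor posLowerDensitySets T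

end Hypercyclicity

section Shift

variable (𝕜 : Type*) [RCLike 𝕜]

theorem memlp_shift {𝕜 : Type*} [RCLike 𝕜] {p : ℝ≥0∞} {x : ℕ → 𝕜}
    (hx : Memℓp (E := fun _ : ℕ => 𝕜) x p) :
    Memℓp (E := fun _ : ℕ => 𝕜) (fun n => x (n + 1)) p := by
  have hinj : Function.Injective (fun n : ℕ => n + 1) := fun a b h => by simpa using h
  rcases p.trichotomy with rfl | rfl | hp
  · rw [memℓp_zero_iff] at hx ⊢
    exact hx.preimage hinj.injOn
  · rw [memℓp_infty_iff] at hx ⊢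
    exact hx.mono (by rintro _ ⟨n, rfl⟩; exact ⟨n + 1, rfl⟩)
  · rw [memℓp_gen_iff hp] at hx ⊢
    exact hx.comp_injective hinj

/-- The unilateral backward shift `(B x)_n = x_{n+1}` on `ℓ^p`. -/
def lpBackwardShift (p : ℝ≥0∞) [Fact (1 ≤ p)] :
    lp (fun _ : ℕ => 𝕜) p →L[𝕜] lp (fun _ : ℕ => 𝕜) p :=
  LinearMap.mkContinuous
    { toFun := fun x => ⟨fun n => x (n + 1), memlp_shift (lp.memℓp x)⟩
      map_add' := fun _ _ => rfl
      map_smul' := fun _ _ => rfl } 1 (by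
    intro x
    rw [one_mul]
    have hinj : Function.Injective (fun n : ℕ => n + 1) := fun a b h => by simpa using h
    rcases eq_or_ne p ∞ with rfl | hp
    · exact lp.norm_le_of_forall_le (norm_nonneg x) fun n => lp.norm_apply_le_norm (by simp) x _
    · have h1 : (1 : ℝ≥0∞) ≤ p := Fact.out
      have hp0 : 0 < p.toReal := ENNReal.toReal_pos (by positivity) hp
      refine lp.norm_le_of_forall_sum_le hp0 (norm_nonneg x) fun s => ?_
      have := lp.sum_rpow_le_norm_rpow hp0 x (s.map ⟨_, hinj⟩)
      rw [Finset.sum_map] at this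
      exact this)

/-- The unilateral backward shift `(B x)_n = x_{n+1}` on `c_0`. -/
def c0BackwardShift : C₀(ℕ, 𝕜) →L[𝕜] C₀(ℕ, 𝕜) :=
  LinearMap.mkContinuous
    { toFun := fun x =>
        { toFun := fun n => x (n + 1)
          continuous_toFun := continuous_of_discreteTopology
          zero_at_infty' := by
            have h := x.zero_at_infty'
            rw [cocompact_eq_cofinite, Nat.cofinite_eq_atTop] at h ⊢
            exact h.comp (tendsto_add_atTop_nat 1) }
      map_add' := fun _ _ => rfl
      map_smul' := fun _ _ => rfl } 1 (by
    intro x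
    rw [one_mul, ← ZeroAtInftyContinuousMap.norm_toBCF_eq_norm,
      ← ZeroAtInftyContinuousMap.norm_toBCF_eq_norm]
    exact (BoundedContinuousFunction.norm_le (norm_nonneg _)).2
      fun n => x.toBCF.norm_coe_le_norm (n + 1))

end Shift

end

/-! Only 4 → 5 and 5 → 1 have content; the rest compares densities. Necessity is a coordinate
obstruction: if `i t ≤ i s`, the 0-th coordinate of `B ^ (n * i s) x` is also a coordinate of `B ^
(n * i t) x`, so `‖lam s‖ ≤ ‖lam t‖` would prevent `T_s ^ n x` from being near `3e` while `T_t ^ n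
x` is near `0`.

For sufficiency, let `S` be a norm-nonincreasing right inverse of `B` and sum `(lam s ^ n)⁻¹ • S^[n
* i s] (y (v n) s)` over `s` and over the times `n` of a set `A`. Under `T_t ^ m` the term `(n, s)`
is killed when `n * i s + v n ≤ m * i t`; otherwise it must be small because `‖lam t‖ ^ m / ‖lam s‖
^ n` is. For `s = t`, gaps `v n + v m` in `A` suffice. For `s ≠ t`, two times must be either nearly
equal in ratio or very far apart: nearly equal times are settled by the strict order of the `i s`
(when `s < t`) or of the `‖lam s‖` (when `t < s`), distant ones by size alone.

Hence `A` lives in short blocks after the powers `Q ^ l`, its points indexed by integers whose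
2-adic valuation is the level `v`. Each level has positive lower density, and since Σ ν₂(j) ≤ n the
gaps cost only a constant factor. The error at time `m` is at most `r ^ v m * C`; a target recurring
at large levels is thus approximated well along a whole level. The core is `exists_separated_set`,
`exists_block_base` and `exists_orbit_close`. -/

/-! ### Comparison of densities -/

theorem finite_sep_le (A : Set ℕ) (N : ℕ) : {n ∈ A | n ≤ N}.Finite :=
  (Set.finite_Iic N).subset fun _ hn => hn.2

theorem lowerDensity_mono {A B : Set ℕ} (h : A ⊆ B) : lowerDensity A ≤ lowerDensity B := by
  refine liminf_le_liminf (Eventually.of_forall fun N => ?_)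
  refine ENNReal.div_le_div_right ?_ _
  have h1 : {n ∈ A | n ≤ N} ⊆ {n ∈ B | n ≤ N} := fun n hn => ⟨h hn.1, hn.2⟩
  exact_mod_cast ncard_le_ncard h1 (finite_sep_le B N)

theorem lowerDensity_pos_of_eventually_le {A : Set ℕ} {c : ℕ}
    (h : ∀ᶠ M : ℕ in atTop, M ≤ c * {n ∈ A | n ≤ M}.ncard) : 0 < lowerDensity A := by
  have h1 : (c : ℝ≥0∞)⁻¹ ≤ lowerDensity A := by
    refine le_liminf_of_le (by isBoundedDefault) ?_
    filter_upwards [h, eventually_gt_atTop 0] with M hM hM0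
    have hM0' : (M : ℝ≥0∞) ≠ 0 := by exact_mod_cast hM0.ne'
    have hc : (c : ℝ≥0∞) ≠ 0 := by
      rintro hc
      have : c = 0 := by exact_mod_cast hc
      subst this
      omega
    rw [ENNReal.le_div_iff_mul_le (Or.inl hM0') (Or.inl (by simp)), mul_comm, ← div_eq_mul_inv]
    refine ENNReal.div_le_of_le_mul' ?_
    exact_mod_cast hM
  exact lt_of_lt_of_le (ENNReal.inv_pos.2 (by simp)) h1

theorem lowerDensity_le_upperDensity (A : Set ℕ) : lowerDensity A ≤ upperDensity A :=
  liminf_le_limsup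

theorem tendsto_const_div_natCast (c : ℝ≥0∞) (hc : c ≠ ∞) :
    Tendsto (fun N : ℕ => c / (N : ℝ≥0∞)) atTop (nhds 0) := by
  simpa [div_eq_mul_inv] using
    ENNReal.Tendsto.const_mul ENNReal.tendsto_inv_nat_nhds_zero (Or.inr hc)

theorem upperDensity_le_upperBanachDensity (A : Set ℕ) :
    upperDensity A ≤ upperBanachDensity A := by
  unfold upperBanachDensity
  rw [← ENNReal.limsup_add_of_right_tendsto_zero (tendsto_const_div_natCast 2 (by simp))]
  refine limsup_le_limsup (Eventually.of_forall fun N => ?_)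
  -- The window for `k = 1` is `[2, N + 1]`, which misses at most `0` and `1`; the loss `2 / N`
  -- vanishes in the limit.
  have h1 : {n ∈ A | n ≤ N}.ncard ≤ (A ∩ Icc (1 + 1) (1 + N)).ncard + 2 := by
    have h2 : {n ∈ A | n ≤ N} ⊆ (A ∩ Icc (1 + 1) (1 + N)) ∪ {0, 1} := by
      rintro n ⟨hn, hnN⟩
      simp only [mem_union, mem_inter_iff, mem_Icc, mem_insert_iff, mem_singleton_iff]
      by_cases h : 2 ≤ n
      · exact Or.inl ⟨hn, by omega, by omega⟩
      · right; omega
    have hf : ((A ∩ Icc (1 + 1) (1 + N)) ∪ {0, 1}).Finite :=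
      ((finite_Icc _ _).subset inter_subset_right).union (by simp)
    refine (ncard_le_ncard h2 hf).trans ((ncard_union_le _ _).trans ?_)
    gcongr
    exact (ncard_insert_le _ _).trans (by simp)
  calc (({n ∈ A | n ≤ N}.ncard : ℕ) : ℝ≥0∞) / (N : ℝ≥0∞)
      ≤ (((A ∩ Icc (1 + 1) (1 + N)).ncard + 2 : ℕ) : ℝ≥0∞) / (N : ℝ≥0∞) := by
        refine ENNReal.div_le_div_right ?_ _
        exact_mod_cast h1
    _ = ((A ∩ Icc (1 + 1) (1 + N)).ncard : ℝ≥0∞) / (N : ℝ≥0∞) + 2 / (N : ℝ≥0∞) := by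
        push_cast
        rw [ENNReal.add_div]
    _ ≤ _ := by
        refine add_le_add ?_ le_rfl
        exact le_iSup₂ (f := fun (k : ℕ) (_ : 1 ≤ k) =>
          (((A ∩ Icc (k + 1) (k + N)).ncard : ℕ) : ℝ≥0∞) / (N : ℝ≥0∞)) 1 le_rfl

theorem upperBanachDensity_eq_zero_of_finite {A : Set ℕ} (hA : A.Finite) :
    upperBanachDensity A = 0 := by
  have h := (tendsto_const_div_natCast (A.ncard : ℝ≥0∞) (by simp)).limsup_eq
  refine le_antisymm (le_trans (limsup_le_limsup (Eventually.of_forall fun N => ?_)) h.le) zero_le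
  refine iSup₂_le fun k _ => ENNReal.div_le_div_right ?_ _
  exact_mod_cast ncard_le_ncard inter_subset_left hA

/-! ### Orbits of the direct sum and the coordinate obstruction -/

section Hypercyclicity

variable {𝕜 : Type*} [RCLike 𝕜] {X : Type*} [NormedAddCommGroup X] [NormedSpace 𝕜 X]

theorem DisjointHypercyclicFor.mono {𝒜 ℬ : Set (Set ℕ)} (h : 𝒜 ⊆ ℬ) {N : ℕ}
    {T : Fin N → X →L[𝕜] X} (hT : DisjointHypercyclicFor 𝒜 T) : DisjointHypercyclicFor ℬ T :=
  let ⟨x, hx⟩ := hT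
  ⟨x, fun U hU hne => h (hx U hU hne)⟩

theorem piMap_pow_apply {N : ℕ} (T : Fin N → X →L[𝕜] X) (n : ℕ) (y : Fin N → X) :
    (ContinuousLinearMap.piMap (R := 𝕜) T ^ n) y = fun s => (T s ^ n) (y s) := by
  induction n with
  | zero => rfl
  | succ n ih =>
    rw [pow_succ', mul_apply_eq_comp, ih]
    funext s
    simp [pow_succ']

theorem smul_pow_pow_apply (B : X →L[𝕜] X) (c : 𝕜) (i n : ℕ) (x : X) :
    ((c • B ^ i) ^ n) x = c ^ n • (B ^ (n * i)) x := by
  rw [smul_pow, ← pow_mul, mul_comm]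
  rfl

theorem norm_pow_apply_le {B : X →L[𝕜] X} (hB : ∀ x, ‖B x‖ ≤ ‖x‖) (n : ℕ) (x : X) :
    ‖(B ^ n) x‖ ≤ ‖x‖ := by
  induction n with
  | zero => simp
  | succ n ih =>
    rw [pow_succ', mul_apply_eq_comp]
    exact (hB _).trans ih

/-- A coordinate obstruction: `T_1 ^ n x` cannot be close to `3e` while `T_2 ^ n x` is close to
`0` if a coordinate of the latter dominates the one of the former. -/
theorem DisjointHypercyclic.exists_lt {N : ℕ} {B : X →L[𝕜] X} (hB : ∀ x, ‖B x‖ ≤ ‖x‖)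
    {φ : X →ₗ[𝕜] 𝕜} (hφ : ∀ x, ‖φ x‖ ≤ ‖x‖) {e : X} (he : φ e = 1) {lam : Fin N → 𝕜}
    {i : Fin N → ℕ} (h : DisjointHypercyclic (fun s => lam s • B ^ i s)) {s t : Fin N}
    (hst : s ≠ t) (hi : i t ≤ i s) : ‖lam t‖ < ‖lam s‖ := by
  obtain ⟨x, hx⟩ := h
  by_contra! hle
  set y : Fin N → X := fun k => if k = s then (3 : 𝕜) • e else 0 with hy
  obtain ⟨n, hn⟩ := (hx (Metric.ball y 1) Metric.isOpen_ball
    ⟨y, Metric.mem_ball_self one_pos⟩).nonempty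
  rw [mem_ofPred_eq, piMap_pow_apply, mem_ball_iff_norm] at hn
  have hs := (norm_le_pi_norm _ s).trans_lt hn
  have ht := (norm_le_pi_norm _ t).trans_lt hn
  simp only [Pi.sub_apply, smul_pow_pow_apply, hy, if_true, if_neg hst.symm, sub_zero] at hs ht
  -- Applying the contraction `B ^ (n * (i s - i t))` to the small vector `T_t ^ n x` exposes the
  -- coordinate used by `T_s`. It ends up of norm below 1, yet within 1 of 3 after scaling by `lam s
  -- ^ n`.
  have h1 : n * i s = n * (i s - i t) + n * i t := by
    rw [← mul_add, Nat.sub_add_cancel hi]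
  have h2 : ‖lam t ^ n * φ ((B ^ (n * i s)) x)‖ < 1 := by
    refine lt_of_le_of_lt ?_ ht
    have := (hφ _).trans (norm_pow_apply_le hB (n * (i s - i t)) (lam t ^ n • (B ^ (n * i t)) x))
    rwa [map_smul, map_smul, ← mul_apply_eq_comp, ← pow_add, ← h1, smul_eq_mul] at this
  have h3 : ‖lam s ^ n * φ ((B ^ (n * i s)) x) - 3‖ < 1 := by
    have := (hφ _).trans_lt hs
    rwa [map_sub, map_smul, map_smul, he, smul_eq_mul, smul_eq_mul, mul_one] at this
  have h4 : ‖lam s ^ n * φ ((B ^ (n * i s)) x)‖ ≤ ‖lam t ^ n * φ ((B ^ (n * i s)) x)‖ := by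
    rw [norm_mul, norm_mul, norm_pow, norm_pow]
    gcongr
  have h5 : ‖(3 : 𝕜)‖ = 3 := by simp
  have h6 := norm_sub_norm_le (3 : 𝕜) (lam s ^ n * φ ((B ^ (n * i s)) x))
  rw [norm_sub_rev] at h6
  linarith

end Hypercyclicity

/-! ### A separated set of times with levels of positive lower density -/

/-- The sum is the 2-adic valuation of `n!`, which Legendre's formula bounds. This keeps
`gapPosition` linear in its index. -/
theorem sum_padicValNat_two_le (n : ℕ) : ∑ j ∈ Finset.range (n + 1), padicValNat 2 j ≤ n := by
  have h : ∑ j ∈ Finset.range (n + 1), padicValNat 2 j = padicValNat 2 n.factorial := by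
    induction n with
    | zero => simp
    | succ n ih =>
      rw [Finset.sum_range_succ, ih, Nat.factorial_succ,
        padicValNat.mul (by omega) (Nat.factorial_ne_zero n), add_comm]
  have h1 := sub_one_mul_padicValNat_factorial (p := 2) n
  omega

/-- The `i`-th position of a sequence of points that leaves a gap `Q * (ν₂(i) + 1)` on both sides
of the `i`-th point. -/
def gapPosition (Q i : ℕ) : ℕ :=
  2 * ∑ j ∈ Finset.range i, Q * (padicValNat 2 j + 1) + Q * (padicValNat 2 i + 1)

theorem gapPosition_add_le (Q : ℕ) {i j : ℕ} (h : i < j) :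
    gapPosition Q i + Q * (padicValNat 2 i + 1) + Q * (padicValNat 2 j + 1) ≤ gapPosition Q j := by
  have h1 : ∑ k ∈ Finset.range (i + 1), Q * (padicValNat 2 k + 1) ≤
      ∑ k ∈ Finset.range j, Q * (padicValNat 2 k + 1) :=
    Finset.sum_le_sum_of_subset (Finset.range_mono h)
  rw [Finset.sum_range_succ] at h1
  unfold gapPosition
  omega

theorem gapPosition_le (Q : ℕ) {i : ℕ} (hi : 1 ≤ i) : gapPosition Q i ≤ 6 * Q * i := by
  have h1 := sum_padicValNat_two_le i
  have h2 : gapPosition Q i ≤ 2 * ∑ j ∈ Finset.range (i + 1), Q * (padicValNat 2 j + 1) := by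
    rw [Finset.sum_range_succ, gapPosition]
    omega
  rw [← Finset.mul_sum, Finset.sum_add_distrib] at h2
  simp only [Finset.sum_const, Finset.card_range, smul_eq_mul, mul_one] at h2
  nlinarith [Nat.mul_le_mul_left Q h1, Nat.mul_le_mul_left Q hi]

theorem le_gapPosition (Q i : ℕ) : Q * (padicValNat 2 i + 1) ≤ gapPosition Q i :=
  Nat.le_add_left _ _

/-- Points in geometrically spaced blocks keep the gaps prescribed by `gapPosition`. -/
theorem block_gap {Q l l' i i' : ℕ} (hQ : 3 ≤ Q) (hi : Q * gapPosition Q i ≤ Q ^ l)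
    (hlt : l < l' ∨ l = l' ∧ i < i') :
    Q ^ l + gapPosition Q i + padicValNat 2 i + padicValNat 2 i' <
      Q ^ l' + gapPosition Q i' := by
  have a1 := le_gapPosition Q i
  have a2 := le_gapPosition Q i'
  have b1 : padicValNat 2 i + 1 ≤ Q * (padicValNat 2 i + 1) := Nat.le_mul_of_pos_left _ (by omega)
  have b2 : padicValNat 2 i' + 1 ≤ Q * (padicValNat 2 i' + 1) :=
    Nat.le_mul_of_pos_left _ (by omega)
  -- Across blocks, `gapPosition Q i` and `padicValNat 2 i` each fit in one `Q ^ l`, which with the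
  -- starting `Q ^ l` makes at most `3 * Q ^ l`; hence `3 ≤ Q`.
  rcases hlt with h | ⟨rfl, h⟩
  · have h1 : Q ^ (l + 1) ≤ Q ^ l' := Nat.pow_le_pow_right (by omega) h
    have h2 : 3 * Q ^ l ≤ Q ^ (l + 1) := by rw [pow_succ, mul_comm]; gcongr
    have h3 : gapPosition Q i ≤ Q * gapPosition Q i := Nat.le_mul_of_pos_left _ (by omega)
    omega
  · have := gapPosition_add_le Q h
    omega

/-- Offsets in block `l` are at most `Q ^ l / Q`, so the block spans a ratio of at most `1 + 1 / Q`.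
-/
theorem block_ratio_eq {Q l i i' : ℕ} (hi : Q * gapPosition Q i ≤ Q ^ l) :
    Q * (Q ^ l + gapPosition Q i) ≤ (Q + 1) * (Q ^ l + gapPosition Q i') := by
  have : Q * (Q ^ l + gapPosition Q i) ≤ (Q + 1) * Q ^ l := by linarith
  exact this.trans (by gcongr; omega)

theorem block_ratio_lt {Q l l' i i' : ℕ} (hQ : 3 ≤ Q) (hi : Q * gapPosition Q i ≤ Q ^ l)
    (h : l < l') : Q * (Q ^ l + gapPosition Q i) ≤ 2 * (Q ^ l' + gapPosition Q i') := by
  have h1 : Q ^ (l + 1) ≤ Q ^ l' := Nat.pow_le_pow_right (by omega) h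
  have h2 : 1 * Q ^ l ≤ Q ^ (l + 1) := by rw [pow_succ, mul_comm]; gcongr; omega
  have h3 : Q * Q ^ l = Q ^ (l + 1) := by rw [pow_succ, mul_comm]
  rw [mul_add, h3]
  omega

theorem padicValNat_two_pow_mul_odd (k q : ℕ) : padicValNat 2 (2 ^ k * (2 * q + 1)) = k := by
  rw [padicValNat.mul (by positivity) (by omega), padicValNat.prime_pow,
    padicValNat.eq_zero_of_not_dvd (by omega), add_zero]

/-- The last block that fits entirely below `M` starts at a power `Q ^ l` comparable to `M`, and the
indices `2 ^ k * (2 * q + 1)` already supply a fixed proportion of `Q ^ l` points there. -/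
theorem lowerDensity_blocks_pos {Q : ℕ} (hQ : 3 ≤ Q) (k : ℕ) :
    0 < lowerDensity {n | ∃ l i, Q * gapPosition Q i ≤ Q ^ l ∧ padicValNat 2 i = k ∧
      n = Q ^ l + gapPosition Q i} := by
  -- Chosen so that `K * R ≤ Q ^ l` admits every index up to `2 ^ k * (2 * R)`, given `gapPosition Q
  -- i ≤ 6 * Q * i`.
  set K := 12 * Q ^ 2 * 2 ^ k with hK
  have hK0 : 0 < K := by positivity
  refine lowerDensity_pos_of_eventually_le (c := 8 * Q * K) ?_
  filter_upwards [eventually_ge_atTop (2 * (Q * K)), eventually_ge_atTop 2] with M hM hM2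
  set l := Nat.log Q (M / 2)
  have hl1 : Q ^ l ≤ M / 2 := Nat.pow_log_le_self Q (by omega)
  have hl2 : M / 2 < Q ^ (l + 1) := Nat.lt_pow_succ_log_self (by omega) _
  rw [pow_succ] at hl2
  set R := Q ^ l / K with hR
  have hKl : K ≤ Q ^ l := by
    have : K * Q ≤ Q ^ l * Q := by
      rw [mul_comm K]
      omega
    exact Nat.le_of_mul_le_mul_right this (by omega)
  have hR1 : 1 ≤ R := (Nat.one_le_div_iff hK0).2 hKl
  have hR2 : K * R ≤ Q ^ l := Nat.mul_div_le _ _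
  have hR3 : Q ^ l < K * (R + 1) := Nat.lt_mul_div_succ _ hK0
  have hcard : R ≤ {n ∈ {n | ∃ l i, Q * gapPosition Q i ≤ Q ^ l ∧ padicValNat 2 i = k ∧
      n = Q ^ l + gapPosition Q i} | n ≤ M}.ncard := by
    have hinj : StrictMono fun q => Q ^ l + gapPosition Q (2 ^ k * (2 * q + 1)) := by
      intro q q' hq
      have h1 : 2 ^ k * (2 * q + 1) < 2 ^ k * (2 * q' + 1) := by gcongr
      have h2 := gapPosition_add_le Q h1
      have h3 : 0 < Q * (padicValNat 2 (2 ^ k * (2 * q + 1)) + 1) := by positivity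
      simp only
      omega
    have h1 : ((Finset.range R).image fun q => Q ^ l + gapPosition Q (2 ^ k * (2 * q + 1))).card
        = R := by
      rw [Finset.card_image_of_injective _ hinj.injective, Finset.card_range]
    rw [← h1, ← Set.ncard_coe_finset]
    refine ncard_le_ncard ?_ (finite_sep_le _ M)
    intro n hn
    simp only [Finset.coe_image, Finset.coe_range, mem_image, mem_Iio] at hn
    obtain ⟨q, hq, rfl⟩ := hn
    have h2 : Q * gapPosition Q (2 ^ k * (2 * q + 1)) ≤ Q ^ l := by
      calc Q * gapPosition Q (2 ^ k * (2 * q + 1))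
          ≤ Q * (6 * Q * (2 ^ k * (2 * q + 1))) := by
            gcongr
            exact gapPosition_le Q (Nat.one_le_iff_ne_zero.2 (by positivity))
        _ ≤ Q * (6 * Q * (2 ^ k * (2 * R))) := by gcongr; omega
        _ = K * R := by rw [hK]; ring
        _ ≤ Q ^ l := hR2
    have h3 : gapPosition Q (2 ^ k * (2 * q + 1)) ≤ Q * gapPosition Q (2 ^ k * (2 * q + 1)) :=
      Nat.le_mul_of_pos_left _ (by omega)
    exact ⟨⟨l, _, h2, padicValNat_two_pow_mul_odd k q, rfl⟩, by omega⟩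
  have h1 : M ≤ 4 * (Q ^ l * Q) := by omega
  calc M ≤ 4 * (Q ^ l * Q) := h1
    _ ≤ 4 * ((K * (R + R)) * Q) := by
      gcongr
      exact hR3.le.trans (by gcongr)
    _ = 8 * Q * K * R := by ring
    _ ≤ _ := Nat.mul_le_mul_left _ hcard

/-- The gaps handle `s = t`, the ratio trichotomy handles `s ≠ t`, and `Q * v n ≤ n` makes the
killing delay `v n` negligible against `n`. -/
theorem exists_separated_set {Q : ℕ} (hQ : 3 ≤ Q) : ∃ (A : Set ℕ) (v : ℕ → ℕ),
    (∀ n ∈ A, ∀ m ∈ A, n < m → n + v n + v m ≤ m) ∧ (∀ n ∈ A, Q * v n ≤ n) ∧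
    (∀ n ∈ A, ∀ m ∈ A, (Q * n ≤ (Q + 1) * m ∧ Q * m ≤ (Q + 1) * n) ∨
      Q * n ≤ 2 * m ∨ Q * m ≤ 2 * n) ∧
    ∀ k, 0 < lowerDensity {n ∈ A | v n = k} := by
  classical
  set A : Set ℕ := {n | ∃ l i, Q * gapPosition Q i ≤ Q ^ l ∧ n = Q ^ l + gapPosition Q i} with hA
  have hch : ∀ n : ℕ, ∃ w : ℕ × ℕ, n ∈ A →
      Q * gapPosition Q w.2 ≤ Q ^ w.1 ∧ n = Q ^ w.1 + gapPosition Q w.2 := by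
    intro n
    by_cases h : n ∈ A
    · obtain ⟨l, i, h1⟩ := h
      exact ⟨(l, i), fun _ => h1⟩
    · exact ⟨(0, 0), fun h' => absurd h' h⟩
  choose w hw using hch
  refine ⟨A, fun n => padicValNat 2 (w n).2, ?_, ?_, ?_, ?_⟩
  · intro n hn m hm hnm
    obtain ⟨h1, h2⟩ := hw n hn
    obtain ⟨h3, h4⟩ := hw m hm
    rcases lt_trichotomy (w n).1 (w m).1 with h | h | h
    · have := block_gap (i' := (w m).2) hQ h1 (Or.inl h)
      simp only
      omega
    · rcases lt_trichotomy (w n).2 (w m).2 with h' | h' | h'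
      · have := block_gap hQ h1 (Or.inr ⟨h, h'⟩)
        simp only
        omega
      · rw [h, h'] at h2
        omega
      · have := block_gap hQ h3 (Or.inr ⟨h.symm, h'⟩)
        omega
    · have := block_gap (i' := (w n).2) hQ h3 (Or.inl h)
      omega
  · intro n hn
    obtain ⟨h1, h2⟩ := hw n hn
    have := le_gapPosition Q (w n).2
    rw [mul_add] at this
    simp only
    omega
  · intro n hn m hm
    obtain ⟨h1, h2⟩ := hw n hn
    obtain ⟨h3, h4⟩ := hw m hm
    rcases lt_trichotomy (w n).1 (w m).1 with h | h | h
    · right; left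
      rw [h2, h4]
      exact block_ratio_lt hQ h1 h
    · left
      rw [h2, h4, ← h]
      exact ⟨block_ratio_eq h1, block_ratio_eq (h ▸ h3)⟩
    · right; right
      rw [h2, h4]
      exact block_ratio_lt hQ h3 h
  · intro k
    refine (lowerDensity_blocks_pos hQ k).trans_le (lowerDensity_mono ?_)
    rintro n ⟨l, i, h1, rfl, rfl⟩
    have hmem : Q ^ l + gapPosition Q i ∈ A := ⟨l, i, h1, rfl⟩
    refine ⟨hmem, ?_⟩
    obtain ⟨h3, h4⟩ := hw _ hmem
    set u := w (Q ^ l + gapPosition Q i)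
    simp only
    -- The representation is unique: by `block_gap`, different pairs give different numbers, so the
    -- chosen index is `i`.
    rcases lt_trichotomy u.1 l with h | h | h
    · have := block_gap (i' := i) hQ h3 (Or.inl h)
      omega
    · rcases lt_trichotomy u.2 i with h' | h' | h'
      · have := block_gap hQ h3 (Or.inr ⟨h, h'⟩)
        omega
      · rw [h']
      · have := block_gap hQ h1 (Or.inr ⟨h.symm, h'⟩)
        omega
    · have := block_gap (i' := u.2) hQ h1 (Or.inl h)
      omega

/-! ### Each cross term is killed or exponentially small -/

/-- Here `a`, `b` stand for logarithms of moduli and `x` for `1 / Q`. At `x = 0` the needed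
inequalities are strict, so they persist for small `x` with a margin left over. -/
theorem eventually_block_dichotomy {a b : ℝ} {i j : ℕ} (ha : 0 < a) (hb : 0 < b) (hj : 1 ≤ j)
    (h : (i < j ∧ a < b) ∨ b < a) :
    ∀ᶠ x : ℝ in nhds 0, 0 < x → ∀ n m : ℝ, 0 ≤ n → 0 ≤ m →
      ((n ≤ (1 + x) * m ∧ m ≤ (1 + x) * n) ∨ n ≤ 2 * x * m ∨ m ≤ 2 * x * n) →
      n * i + x * n ≤ m * j ∨ m * b + x * (n + m) ≤ n * a := by
  have hj' : (1 : ℝ) ≤ j := by exact_mod_cast hj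
  have h2 : ∀ᶠ x : ℝ in nhds 0, 2 * x * (i + x) < 1 :=
    ContinuousAt.eventually_lt (by fun_prop) (by fun_prop) (by norm_num)
  have h3 : ∀ᶠ x : ℝ in nhds 0, 2 * x * b + x * (1 + 2 * x) < a :=
    ContinuousAt.eventually_lt (by fun_prop) (by fun_prop) (by simpa using ha)
  have h1 : ∀ᶠ x : ℝ in nhds 0, (1 + x) * (i + x) < j ∨ (1 + x) * b + x * (2 + x) < a := by
    rcases h with ⟨hij, -⟩ | h
    · have hij' : (i : ℝ) < j := by exact_mod_cast hij
      have : ∀ᶠ x : ℝ in nhds 0, (1 + x) * (i + x) < j :=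
        ContinuousAt.eventually_lt (by fun_prop) (by fun_prop) (by simpa using hij')
      exact this.mono fun x => Or.inl
    · have : ∀ᶠ x : ℝ in nhds 0, (1 + x) * b + x * (2 + x) < a :=
        ContinuousAt.eventually_lt (by fun_prop) (by fun_prop) (by simpa using h)
      exact this.mono fun x => Or.inr
  filter_upwards [h1, h2, h3] with x h1 h2 h3 hx n m hn hm hnm
  have hix : (0 : ℝ) ≤ i + x := by positivity
  rcases hnm with ⟨hA, hB⟩ | hA | hB
  · rcases h1 with h1 | h1
    · left
      calc n * i + x * n = n * (i + x) := by ring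
        _ ≤ (1 + x) * m * (i + x) := by gcongr
        _ = m * ((1 + x) * (i + x)) := by ring
        _ ≤ m * j := by gcongr
    · right
      calc m * b + x * (n + m) ≤ (1 + x) * n * b + x * (n + (1 + x) * n) := by gcongr
        _ = n * ((1 + x) * b + x * (2 + x)) := by ring
        _ ≤ n * a := by gcongr
  · left
    calc n * i + x * n = n * (i + x) := by ring
      _ ≤ 2 * x * m * (i + x) := by gcongr
      _ = m * (2 * x * (i + x)) := by ring
      _ ≤ m * j := by
        gcongr
        exact h2.le.trans hj'
  · right
    calc m * b + x * (n + m) ≤ 2 * x * n * b + x * (n + 2 * x * n) := by gcongr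
      _ = n * (2 * x * b + x * (1 + 2 * x)) := by ring
      _ ≤ n * a := by gcongr

theorem exists_block_base {N : ℕ} {a : Fin N → ℝ} {i : Fin N → ℕ} (ha : ∀ s, 0 < a s)
    (hi : ∀ s, 1 ≤ i s) (h : ∀ s t, s < t → i s < i t ∧ a s < a t) :
    ∃ Q : ℕ, 3 ≤ Q ∧ ∀ s t, s ≠ t → ∀ n m : ℕ,
      ((Q * n ≤ (Q + 1) * m ∧ Q * m ≤ (Q + 1) * n) ∨ Q * n ≤ 2 * m ∨ Q * m ≤ 2 * n) →
      (n * i s + (1 / Q : ℝ) * n ≤ m * i t) ∨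
        m * a t + (1 / Q : ℝ) * (n + m) ≤ n * a s := by
  have h1 : ∀ᶠ x : ℝ in nhds 0, ∀ s t, s ≠ t → 0 < x → ∀ n m : ℝ, 0 ≤ n → 0 ≤ m →
      ((n ≤ (1 + x) * m ∧ m ≤ (1 + x) * n) ∨ n ≤ 2 * x * m ∨ m ≤ 2 * x * n) →
      n * i s + x * n ≤ m * i t ∨ m * a t + x * (n + m) ≤ n * a s := by
    refine eventually_all.2 fun s => eventually_all.2 fun t => ?_
    by_cases hst : s = t
    · exact Eventually.of_forall fun _ hne => absurd hst hne
    · refine (eventually_block_dichotomy (ha s) (ha t) (hi t) ?_).mono fun x hx _ => hx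
      rcases lt_or_gt_of_ne hst with hlt | hlt
      · exact Or.inl (h s t hlt)
      · exact Or.inr (h t s hlt).2
  obtain ⟨Q, hQ, hQ3⟩ := ((tendsto_one_div_atTop_nhds_zero_nat (𝕜 := ℝ)).eventually h1 |>.and
    (eventually_ge_atTop 3)).exists
  have hQ0 : (0 : ℝ) < Q := by
    have : 0 < Q := by omega
    exact_mod_cast this
  refine ⟨Q, hQ3, fun s t hst n m hnm => ?_⟩
  refine hQ s t hst (by positivity) n m (by positivity) (by positivity) ?_
  have key : ∀ k l : ℕ, Q * k ≤ (Q + 1) * l → (k : ℝ) ≤ (1 + 1 / Q) * l := by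
    intro k l hkl
    have : (Q : ℝ) * k ≤ (Q + 1) * l := by exact_mod_cast hkl
    rw [show (1 + 1 / Q : ℝ) * l = ((Q + 1) * l) / Q by field_simp, le_div_iff₀ hQ0]
    linarith
  have key2 : ∀ k l : ℕ, Q * k ≤ 2 * l → (k : ℝ) ≤ 2 * (1 / Q) * l := by
    intro k l hkl
    have : (Q : ℝ) * k ≤ 2 * l := by exact_mod_cast hkl
    rw [show 2 * (1 / Q : ℝ) * l = (2 * l) / Q by field_simp, le_div_iff₀ hQ0]
    linarith
  rcases hnm with ⟨hA, hB⟩ | hA | hB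
  · exact Or.inl ⟨key _ _ hA, key _ _ hB⟩
  · exact Or.inr (Or.inl (key2 _ _ hA))
  · exact Or.inr (Or.inr (key2 _ _ hB))

/-- The square lets one factor `r` pay for the decay in the level and the other for summability. -/
theorem exists_contraction_rate {N : ℕ} {b : Fin N → ℝ} {c : ℝ} (hb : ∀ s, b s < 1)
    (hc : c < 1) : ∃ r : ℝ, 0 < r ∧ r < 1 ∧ (∀ s, b s ≤ r ^ 2) ∧ c ≤ r := by
  have h1 : ∀ᶠ r : ℝ in nhdsWithin 1 (Iio 1), ∀ s, b s < r ^ 2 :=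
    nhdsWithin_le_nhds (eventually_all.2 fun s =>
      ContinuousAt.eventually_lt (by fun_prop) (by fun_prop) (by simpa using hb s))
  have h2 : ∀ᶠ r : ℝ in nhdsWithin 1 (Iio 1), c < r ∧ 0 < r :=
    nhdsWithin_le_nhds ((eventually_gt_nhds hc).and (eventually_gt_nhds one_pos))
  obtain ⟨r, ⟨h1, h2⟩, h3⟩ := ((h1.and h2).and self_mem_nhdsWithin).exists
  exact ⟨r, h2.2, h3, fun s => (h1 s).le, h2.1.le⟩

/-! ### Construction of the vector from a contraction with a right inverse -/

section

variable {𝕜 : Type*} [RCLike 𝕜] {X : Type*} [NormedAddCommGroup X] [NormedSpace 𝕜 X]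

theorem pow_apply_iterate_rightInverse {B : X →L[𝕜] X} {S : X → X} (hBS : ∀ x, B (S x) = x)
    (n : ℕ) (x : X) : (B ^ n) (S^[n] x) = x := by
  induction n with
  | zero => simp
  | succ n ih =>
    rw [pow_succ, mul_apply_eq_comp, Function.iterate_succ_apply', hBS, ih]

theorem norm_iterate_le {S : X → X} (hS : ∀ x, ‖S x‖ ≤ ‖x‖) (n : ℕ) (x : X) :
    ‖S^[n] x‖ ≤ ‖x‖ := by
  induction n with
  | zero => simp
  | succ n ih =>
    rw [Function.iterate_succ_apply']
    exact (hS _).trans ih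

theorem pow_apply_eq_zero_of_le {B : X →L[𝕜] X} {d n : ℕ} (hdn : d ≤ n) {x : X}
    (hx : (B ^ d) x = 0) : (B ^ n) x = 0 := by
  rw [← Nat.sub_add_cancel hdn, pow_add, mul_apply_eq_comp, hx, map_zero]

theorem pow_apply_iterate_eq_zero {B : X →L[𝕜] X} {S : X → X} (hBS : ∀ x, B (S x) = x)
    {d m n : ℕ} {x : X} (hx : (B ^ d) x = 0) (h : n + d ≤ m) : (B ^ m) (S^[n] x) = 0 := by
  rw [← Nat.sub_add_cancel (le_of_add_le_left h), pow_add, mul_apply_eq_comp,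
    pow_apply_iterate_rightInverse hBS]
  exact pow_apply_eq_zero_of_le (by omega) hx

/-- A vector whose orbit under all `T_s = λ_s B ^ {i_s}` at once follows prescribed targets,
visiting each along a set of positive lower density. -/
theorem exists_orbit_close [CompleteSpace X] {B : X →L[𝕜] X} {S : X → X}
    (hB : ∀ x, ‖B x‖ ≤ ‖x‖) (hS : ∀ x, ‖S x‖ ≤ ‖x‖) (hBS : ∀ x, B (S x) = x)
    {N : ℕ} {lam : Fin N → 𝕜} {i : Fin N → ℕ} (hlam : ∀ s, 1 < ‖lam s‖) (hi : ∀ s, 1 ≤ i s)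
    (h : ∀ s t, s < t → i s < i t ∧ ‖lam s‖ < ‖lam t‖) {y : ℕ → Fin N → X}
    (hy : ∀ v s, ‖y v s‖ ≤ v) (hBy : ∀ v s, (B ^ v) (y v s) = 0) :
    ∃ (x : X) (A : Set ℕ) (v : ℕ → ℕ) (r C : ℝ), 0 < r ∧ r < 1 ∧
      (∀ k, 0 < lowerDensity {n ∈ A | v n = k}) ∧
      ∀ m ∈ A, ∀ t, ‖((lam t • B ^ i t) ^ m) x - y (v m) t‖ ≤ r ^ v m * C := by
  classical
  have hlam0 : ∀ s, 0 < ‖lam s‖ := fun s => one_pos.trans (hlam s)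
  obtain ⟨Q, hQ3, hQ⟩ := exists_block_base (a := fun s => Real.log ‖lam s‖)
    (fun s => Real.log_pos (hlam s)) hi
    fun s t hst => ⟨(h s t hst).1, Real.log_lt_log (hlam0 s) (h s t hst).2⟩
  have hQ0 : (0 : ℝ) < Q := by
    have : 0 < Q := by omega
    exact_mod_cast this
  obtain ⟨A, v, hsep, hQv, htri, hdens⟩ := exists_separated_set hQ3
  obtain ⟨r, hr0, hr1, hrlam, hrQ⟩ := exists_contraction_rate (b := fun s => ‖lam s‖⁻¹)
    (c := Real.exp (-(1 / Q))) (fun s => inv_lt_one_of_one_lt₀ (hlam s))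
    ((Real.exp_lt_exp.2 (by rw [neg_lt_zero]; positivity)).trans_eq Real.exp_zero)
  have hvle : ∀ n ∈ A, v n ≤ n := fun n hn =>
    (Nat.le_mul_of_pos_left _ (by omega)).trans (hQv n hn)
  set Y : ℕ → Fin N → X := fun n s => if n ∈ A then y (v n) s else 0 with hY
  have hYn : ∀ n s, ‖Y n s‖ ≤ n := by
    intro n s
    simp only [hY]
    split_ifs with hn
    · exact (hy _ _).trans (by exact_mod_cast hvle n hn)
    · simp
  have hG : Summable fun n : ℕ => (n : ℝ) * r ^ n := by
    simpa using summable_pow_mul_geometric_of_norm_lt_one 1 (r := r)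
      (by rwa [Real.norm_of_nonneg hr0.le])
  set u : ℕ → X := fun n => ∑ s, (lam s ^ n)⁻¹ • S^[n * i s] (Y n s) with hu
  have hun : ∀ n, ‖u n‖ ≤ N * (n * r ^ n) := by
    intro n
    refine (norm_sum_le _ _).trans ?_
    refine (Finset.sum_le_card_nsmul _ _ (n * r ^ n) fun s _ => ?_).trans (by simp)
    rw [norm_smul, norm_inv, norm_pow, ← inv_pow, mul_comm]
    refine mul_le_mul ((norm_iterate_le hS _ _).trans (hYn n s)) ?_ (by positivity) (by positivity)
    refine pow_le_pow_left₀ (by positivity) ((hrlam s).trans ?_) n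
    exact pow_le_of_le_one hr0.le hr1.le two_ne_zero
  have hsu : Summable u := Summable.of_norm_bounded (hG.mul_left (N : ℝ)) hun
  refine ⟨∑' n, u n, A, v, r, N * (∑' n : ℕ, n * r ^ n) + ∑' n : ℕ, n * r ^ n, hr0, hr1, hdens,
    fun m hm t => ?_⟩
  set F : ℕ → Fin N → X := fun n s => lam t ^ m • (lam s ^ n)⁻¹ •
    (B ^ (m * i t)) (S^[n * i s] (Y n s)) with hF
  have hTu : HasSum (fun n => ∑ s, F n s) (((lam t • B ^ i t) ^ m) (∑' n, u n)) := by
    convert ((lam t • B ^ i t) ^ m).hasSum hsu.hasSum using 2 with n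
    simp only [hF, hu, map_sum, map_smul, smul_pow_pow_apply]
    refine Finset.sum_congr rfl fun s _ => ?_
    rw [smul_comm]
  have hE := hTu.sub (hasSum_ite_eq m (Y m t))
  have hYm : Y m t = y (v m) t := if_pos hm
  rw [hYm] at hE
  -- Truncated subtraction annihilates the terms `n ≤ m`, so the sum does not depend on `m`, and
  -- neither does `C`.
  have hshift : HasSum (fun n : ℕ => ((n - m : ℕ) : ℝ) * r ^ (n - m)) (∑' n : ℕ, n * r ^ n) := by
    rw [← hasSum_nat_add_iff' m]
    have h0 : ∑ k ∈ Finset.range m, ((k - m : ℕ) : ℝ) * r ^ (k - m) = 0 := by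
      refine Finset.sum_eq_zero fun k hk => ?_
      rw [Nat.sub_eq_zero_of_le (Finset.mem_range.1 hk).le]
      simp
    rw [h0, sub_zero]
    simpa using hG.hasSum
  have hbound : HasSum (fun n : ℕ => r ^ v m * (N * (n * r ^ n) +
      ((n - m : ℕ) : ℝ) * r ^ (n - m)))
      (r ^ v m * (N * (∑' n : ℕ, n * r ^ n) + ∑' n : ℕ, n * r ^ n)) :=
    ((hG.hasSum.mul_left (N : ℝ)).add hshift).mul_left _
  have hFle : ∀ n s, ‖F n s‖ ≤ ‖lam t‖ ^ m * (‖lam s‖ ^ n)⁻¹ * ‖Y n s‖ := by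
    intro n s
    simp only [hF]
    rw [norm_smul, norm_smul, norm_inv, norm_pow, norm_pow, ← mul_assoc]
    gcongr
    exact (norm_pow_apply_le hB _ _).trans (norm_iterate_le hS _ _)
  have hF0 : ∀ n s, n ∉ A → F n s = 0 := by
    intro n s hn
    have := hFle n s
    rw [show Y n s = 0 from if_neg hn, norm_zero, mul_zero] at this
    exact norm_le_zero_iff.1 this
  have hFzero : ∀ n s, n ∈ A → n * i s + v n ≤ m * i t → F n s = 0 := by
    intro n s hn hle
    have : (B ^ (m * i t)) (S^[n * i s] (Y n s)) = 0 :=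
      pow_apply_iterate_eq_zero hBS (d := v n) (by rw [hY]; simp only [if_pos hn, hBy]) hle
    simp only [hF, this, smul_zero]
  have hYv : ∀ n s, n ∈ A → ‖Y n s‖ ≤ v n := fun n s hn => by
    simp only [hY, if_pos hn]
    exact hy _ _
  have hoff : ∀ n s, s ≠ t → ‖F n s‖ ≤ r ^ v m * (n * r ^ n) := by
    intro n s hst
    by_cases hn : n ∈ A
    swap
    · rw [hF0 n s hn, norm_zero]
      positivity
    rcases hQ s t hst n m (htri n hn m hm) with h1 | h1
    · rw [hFzero n s hn, norm_zero]
      · positivity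
      · have h2 : (v n : ℝ) ≤ (1 / Q : ℝ) * n := by
          rw [one_div, inv_mul_eq_div, le_div_iff₀ hQ0, mul_comm]
          exact_mod_cast hQv n hn
        have h3 : (n : ℝ) * i s + v n ≤ m * i t := by linarith
        exact_mod_cast h3
    · have h2 : ‖lam t‖ ^ m * (‖lam s‖ ^ n)⁻¹ ≤ r ^ v m * r ^ n := by
        calc ‖lam t‖ ^ m * (‖lam s‖ ^ n)⁻¹
            = Real.exp (m * Real.log ‖lam t‖ - n * Real.log ‖lam s‖) := by
              rw [Real.exp_sub, Real.exp_nat_mul, Real.exp_nat_mul, Real.exp_log (hlam0 t),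
                Real.exp_log (hlam0 s), div_eq_mul_inv]
          -- The margin `(n + m) / Q` from `exists_block_base` gives decay in both times: `r ^ m`
          -- yields `r ^ v m`, and `r ^ n` stays summable.
          _ ≤ Real.exp ((m + n : ℕ) * (-(1 / Q))) := by
              rw [Real.exp_le_exp]
              push_cast
              linarith
          _ = Real.exp (-(1 / Q)) ^ (m + n) := Real.exp_nat_mul _ _
          _ ≤ r ^ (m + n) := by gcongr
          _ = r ^ m * r ^ n := pow_add _ _ _
          _ ≤ r ^ v m * r ^ n := by
              gcongr ?_ * _
              exact pow_le_pow_of_le_one hr0.le hr1.le (hvle m hm)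
      calc ‖F n s‖ ≤ ‖lam t‖ ^ m * (‖lam s‖ ^ n)⁻¹ * ‖Y n s‖ := hFle n s
        _ ≤ (r ^ v m * r ^ n) * n := by
          gcongr
          exact hYn n s
        _ = r ^ v m * (n * r ^ n) := by ring
  have hon : ∀ n, ‖F n t - (if n = m then y (v m) t else 0)‖ ≤
      r ^ v m * (((n - m : ℕ) : ℝ) * r ^ (n - m)) := by
    intro n
    by_cases hn : n ∈ A
    swap
    · rw [hF0 n t hn, if_neg (by rintro rfl; exact hn hm), sub_zero, norm_zero]
      positivity
    rcases lt_trichotomy n m with hnm | rfl | hnm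
    · rw [if_neg hnm.ne, sub_zero, hFzero n t hn, norm_zero]
      · positivity
      · have h1 := hsep n hn m hm hnm
        calc n * i t + v n ≤ n * i t + v n * i t := by
              gcongr
              exact Nat.le_mul_of_pos_right _ (hi t)
          _ = (n + v n) * i t := by ring
          _ ≤ m * i t := by gcongr; omega
    · have : F n t = y (v n) t := by
        simp only [hF, pow_apply_iterate_rightInverse hBS, hYm]
        rw [smul_smul, mul_inv_cancel₀, one_smul]
        exact pow_ne_zero _ (norm_pos_iff.1 (hlam0 t))
      rw [if_pos rfl, this, sub_self, norm_zero]
      positivity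
    · have h1 := hsep m hm n hn hnm
      rw [if_neg hnm.ne', sub_zero]
      have h2 : ‖lam t‖ ^ m * (‖lam t‖ ^ n)⁻¹ ≤ r ^ v m * r ^ (n - m) := by
        calc ‖lam t‖ ^ m * (‖lam t‖ ^ n)⁻¹ = ‖lam t‖⁻¹ ^ (n - m) := by
              have : ‖lam t‖ ^ n = ‖lam t‖ ^ m * ‖lam t‖ ^ (n - m) := by
                rw [← pow_add, Nat.add_sub_cancel' hnm.le]
              rw [this, mul_inv, ← mul_assoc, mul_inv_cancel₀ (pow_pos (hlam0 t) m).ne', one_mul,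
                inv_pow]
          _ ≤ (r ^ 2) ^ (n - m) := pow_le_pow_left₀ (by positivity) (hrlam t) _
          _ = r ^ (n - m) * r ^ (n - m) := by rw [← pow_mul, two_mul, pow_add]
          _ ≤ r ^ v m * r ^ (n - m) := by
              -- The gap gives `v m ≤ n - m`.
              gcongr ?_ * _
              exact pow_le_pow_of_le_one hr0.le hr1.le (by omega)
      have h3 : ‖Y n t‖ ≤ ((n - m : ℕ) : ℝ) := by
        refine (hYv n t hn).trans ?_
        have : v n ≤ n - m := by omega
        exact_mod_cast this
      calc ‖F n t‖ ≤ ‖lam t‖ ^ m * (‖lam t‖ ^ n)⁻¹ * ‖Y n t‖ := hFle n t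
        _ ≤ (r ^ v m * r ^ (n - m)) * ((n - m : ℕ) : ℝ) := by gcongr
        _ = r ^ v m * (((n - m : ℕ) : ℝ) * r ^ (n - m)) := by ring
  rw [← hE.tsum_eq]
  refine tsum_of_norm_bounded hbound fun n => ?_
  rw [← Finset.add_sum_erase _ _ (Finset.mem_univ t), add_sub_right_comm, mul_add,
    add_comm (r ^ v m * _)]
  refine (norm_add_le _ _).trans (add_le_add (hon n) ?_)
  refine (norm_sum_le _ _).trans ?_
  refine (Finset.sum_le_card_nsmul _ _ (r ^ v m * (n * r ^ n)) fun s hs =>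
    hoff n s (Finset.ne_of_mem_erase hs)).trans ?_
  rw [nsmul_eq_mul, mul_left_comm]
  gcongr
  have : (Finset.univ.erase t).card ≤ N := (Finset.card_erase_le).trans (by simp)
  exact_mod_cast this

/-- Recurrent enumeration of a dense family of vectors that `B` kills at a controlled time. -/
theorem exists_recurrent_dense_seq {B : X →L[𝕜] X} {e : ℕ → X}
    (he : Dense (Submodule.span 𝕜 (range e) : Set X)) (hBe : ∀ n, (B ^ (n + 1)) (e n) = 0)
    (N : ℕ) : ∃ y : ℕ → Fin N → X, (∀ v s, ‖y v s‖ ≤ v) ∧ (∀ v s, (B ^ v) (y v s) = 0) ∧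
      ∀ U : Set (Fin N → X), IsOpen U → U.Nonempty → ∃ z ∈ U, ∃ᶠ v in atTop, y v = z := by
  have hker : ∀ x ∈ Submodule.span 𝕜 (range e), ∃ d, (B ^ d) x = 0 := by
    intro x hx
    induction hx using Submodule.span_induction with
    | mem x hx =>
      obtain ⟨n, rfl⟩ := hx
      exact ⟨n + 1, hBe n⟩
    | zero => exact ⟨0, by simp⟩
    | add x y _ _ hx hy =>
      obtain ⟨d, hd⟩ := hx
      obtain ⟨d', hd'⟩ := hy
      refine ⟨max d d', ?_⟩
      rw [map_add, pow_apply_eq_zero_of_le (le_max_left _ _) hd,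
        pow_apply_eq_zero_of_le (le_max_right _ _) hd', add_zero]
    | smul c x _ hx =>
      obtain ⟨d, hd⟩ := hx
      exact ⟨d, by rw [map_smul, hd, smul_zero]⟩
  have hsepX : TopologicalSpace.SeparableSpace X := by
    have h1 : TopologicalSpace.IsSeparable (closure (Submodule.span 𝕜 (range e) : Set X)) :=
      ((countable_range e).isSeparable.span (R := 𝕜)).closure
    rw [he.closure_eq] at h1
    exact TopologicalSpace.isSeparable_univ_iff.1 h1
  set D : Set (Fin N → X) := Set.pi univ fun _ => (Submodule.span 𝕜 (range e) : Set X) with hD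
  have hDd : Dense D := dense_pi univ fun _ _ => he
  obtain ⟨E, hED, hEc, hEd⟩ := hDd.exists_countable_dense_subset
  obtain ⟨z, hz⟩ := hEc.exists_eq_range hEd.nonempty
  have hzk : ∀ k, ∃ d : ℕ, ∀ s, ‖z k s‖ ≤ d ∧ (B ^ d) (z k s) = 0 := by
    intro k
    have h1 : ∀ s, ∃ d, (B ^ d) (z k s) = 0 := fun s =>
      hker _ (hED (hz ▸ mem_range_self k) s (mem_univ s))
    choose d hd using h1
    refine ⟨max ⌈‖z k‖⌉₊ (Finset.univ.sup d), fun s => ⟨?_, ?_⟩⟩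
    · refine (norm_le_pi_norm _ s).trans ((Nat.le_ceil _).trans ?_)
      exact_mod_cast le_max_left _ _
    · exact pow_apply_eq_zero_of_le
        ((Finset.le_sup (Finset.mem_univ s)).trans (le_max_right _ _)) (hd s)
  choose d hd using hzk
  -- Pairing makes every `z k` recur at arbitrarily large `v`; `0` fills the indices too small for
  -- the bounds attached to `z k`.
  refine ⟨fun v => if d v.unpair.1 ≤ v then z v.unpair.1 else 0, fun v s => ?_, fun v s => ?_, ?_⟩
  · dsimp only
    split_ifs with hv
    · exact ((hd _ s).1).trans (by exact_mod_cast hv)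
    · simp
  · dsimp only
    split_ifs with hv
    · exact pow_apply_eq_zero_of_le hv (hd _ s).2
    · simp
  · intro U hU hne
    obtain ⟨_, hzU, hzE⟩ := hEd.inter_open_nonempty U hU hne
    rw [hz] at hzE
    obtain ⟨k, rfl⟩ := hzE
    refine ⟨z k, hzU, frequently_atTop.2 fun V => ?_⟩
    have h1 := Nat.right_le_pair k (max V (d k))
    refine ⟨Nat.pair k (max V (d k)), (le_max_left _ _).trans h1, ?_⟩
    simp only [Nat.unpair_pair]
    exact if_pos ((le_max_right _ _).trans h1)

theorem disjointFrequentlyHypercyclic_of_lt [CompleteSpace X] {B : X →L[𝕜] X} {S : X → X}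
    (hB : ∀ x, ‖B x‖ ≤ ‖x‖) (hS : ∀ x, ‖S x‖ ≤ ‖x‖) (hBS : ∀ x, B (S x) = x) {e : ℕ → X}
    (he : Dense (Submodule.span 𝕜 (range e) : Set X)) (hBe : ∀ n, (B ^ (n + 1)) (e n) = 0)
    {N : ℕ} {lam : Fin N → 𝕜} {i : Fin N → ℕ} (hlam : ∀ s, 1 < ‖lam s‖) (hi : ∀ s, 1 ≤ i s)
    (h : ∀ s t, s < t → i s < i t ∧ ‖lam s‖ < ‖lam t‖) :
    DisjointFrequentlyHypercyclic (fun s => lam s • B ^ i s) := by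
  obtain ⟨y, hy, hBy, hyU⟩ := exists_recurrent_dense_seq he hBe N
  obtain ⟨x, A, v, r, C, hr0, hr1, hdens, hx⟩ := exists_orbit_close hB hS hBS hlam hi h hy hBy
  refine ⟨x, fun U hU hne => ?_⟩
  obtain ⟨z, hzU, hz⟩ := hyU U hU hne
  obtain ⟨ε, hε, hball⟩ := Metric.isOpen_iff.1 hU z hzU
  have hlim : Tendsto (fun k : ℕ => r ^ k * C) atTop (nhds 0) := by
    simpa using (tendsto_pow_atTop_nhds_zero_of_lt_one hr0.le hr1).mul_const C
  -- One level both carries the target `z` and makes the error smaller than `ε`; all its times then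
  -- succeed.
  obtain ⟨k, hk, hkε⟩ := (hz.and_eventually (hlim.eventually_lt_const hε)).exists
  refine (hdens k).trans_le (lowerDensity_mono ?_)
  rintro m ⟨hm, hmk⟩
  refine hball ?_
  rw [mem_ball_iff_norm, piMap_pow_apply, pi_norm_lt_iff hε]
  intro t
  refine lt_of_le_of_lt ?_ hkε
  have := hx m hm t
  rwa [hmk, hk] at this

/-- This isolates what is needed of the space. `S` need not be linear or continuous, since only `B
(S x) = x` and the norm bound enter. -/
theorem tfae_disjointHypercyclic [CompleteSpace X] {B : X →L[𝕜] X} {S : X → X}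
    (hB : ∀ x, ‖B x‖ ≤ ‖x‖) (hS : ∀ x, ‖S x‖ ≤ ‖x‖) (hBS : ∀ x, B (S x) = x) {e : ℕ → X}
    (he : Dense (Submodule.span 𝕜 (range e) : Set X)) (hBe : ∀ n, (B ^ (n + 1)) (e n) = 0)
    {φ : X →ₗ[𝕜] 𝕜} (hφ : ∀ x, ‖φ x‖ ≤ ‖x‖) (hφe : φ (e 0) = 1)
    {N : ℕ} {lam : Fin N → 𝕜} {i : Fin N → ℕ} (hlam : ∀ s, 1 < ‖lam s‖)
    (hmono : ∀ s t, s ≤ t → ‖lam s‖ ≤ ‖lam t‖) (hi : ∀ s, 1 ≤ i s) :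
    List.TFAE [
      DisjointFrequentlyHypercyclic (fun s => lam s • B ^ i s),
      DisjointUpperFrequentlyHypercyclic (fun s => lam s • B ^ i s),
      DisjointReiterativelyHypercyclic (fun s => lam s • B ^ i s),
      DisjointHypercyclic (fun s => lam s • B ^ i s),
      ∀ s t, s < t → i s < i t ∧ ‖lam s‖ < ‖lam t‖] := by
  tfae_have 1 → 2 := DisjointHypercyclicFor.mono fun A hA =>
    lt_of_lt_of_le hA (lowerDensity_le_upperDensity A)
  tfae_have 2 → 3 := DisjointHypercyclicFor.mono fun A hA =>
    lt_of_lt_of_le hA (upperDensity_le_upperBanachDensity A)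
  tfae_have 3 → 4 := DisjointHypercyclicFor.mono fun A hA hfin =>
    (ne_of_gt hA) (upperBanachDensity_eq_zero_of_finite hfin)
  tfae_have 4 → 5 := by
    intro h s t hst
    have hit : i s < i t := by
      by_contra! hle
      exact (h.exists_lt hB hφ hφe hst.ne hle).not_ge (hmono s t hst.le)
    exact ⟨hit, h.exists_lt hB hφ hφe hst.ne' hit.le⟩
  tfae_have 5 → 1 := disjointFrequentlyHypercyclic_of_lt hB hS hBS he hBe hlam hi
  tfae_finish

end

/-! ### The backward shift on `ℓ^p` and `c_0` -/

section

variable {𝕜 : Type*} [RCLike 𝕜]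

/-- Prepend a zero to a sequence. -/
def prependZero (x : ℕ → 𝕜) : ℕ → 𝕜
  | 0 => 0
  | n + 1 => x n

section Lp

variable {p : ℝ≥0∞} [Fact (1 ≤ p)]

theorem lp_toReal_pos (hp : p ≠ ∞) : 0 < p.toReal :=
  ENNReal.toReal_pos (zero_lt_one.trans_le Fact.out).ne' hp

theorem norm_lpBackwardShift_le (x : lp (fun _ : ℕ => 𝕜) p) : ‖lpBackwardShift 𝕜 p x‖ ≤ ‖x‖ := by
  refine ((lpBackwardShift 𝕜 p).le_opNorm x).trans ?_
  refine mul_le_of_le_one_left (norm_nonneg _) ?_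
  exact LinearMap.mkContinuous_norm_le _ zero_le_one _

theorem exists_lpBackwardShift_eq (hp : p ≠ ∞) (x : lp (fun _ : ℕ => 𝕜) p) :
    ∃ y, lpBackwardShift 𝕜 p y = x ∧ ‖y‖ ≤ ‖x‖ := by
  have hp0 := lp_toReal_pos hp
  have h1 : Summable fun n => ‖prependZero x (n + 1)‖ ^ p.toReal :=
    (memℓp_gen_iff hp0).1 (lp.memℓp x)
  have hs : Summable fun n => ‖prependZero x n‖ ^ p.toReal := (summable_nat_add_iff 1).1 h1
  let y : lp (fun _ : ℕ => 𝕜) p := ⟨prependZero x, (memℓp_gen_iff hp0).2 hs⟩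
  refine ⟨y, rfl, ?_⟩
  refine lp.norm_le_of_tsum_le hp0 (norm_nonneg x) ?_
  rw [lp.norm_rpow_eq_tsum hp0]
  change ∑' n, ‖prependZero x n‖ ^ p.toReal ≤ _
  rw [hs.tsum_eq_zero_add]
  simp [prependZero, Real.zero_rpow hp0.ne']

theorem lpBackwardShift_pow_apply (k : ℕ) (x : lp (fun _ : ℕ => 𝕜) p) (n : ℕ) :
    (lpBackwardShift 𝕜 p ^ k) x n = x (n + k) := by
  induction k generalizing x with
  | zero => rfl
  | succ k ih =>
    rw [pow_succ, mul_apply_eq_comp, ih]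
    rfl

theorem dense_span_lp_single (hp : p ≠ ∞) :
    Dense (Submodule.span 𝕜 (range fun n : ℕ =>
      (lp.single p n (1 : 𝕜) : lp (fun _ : ℕ => 𝕜) p)) : Set (lp (fun _ : ℕ => 𝕜) p)) := by
  intro x
  refine mem_closure_of_tendsto (lp.hasSum_single hp x) (Eventually.of_forall fun s => ?_)
  refine Submodule.sum_mem _ fun n _ => ?_
  have : (lp.single p n (x n) : lp (fun _ : ℕ => 𝕜) p) = x n • lp.single p n (1 : 𝕜) := by
    rw [← lp.single_smul, smul_eq_mul, mul_one]
  rw [this]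
  exact Submodule.smul_mem _ _ (Submodule.subset_span (mem_range_self n))

end Lp

section C0

theorem C0.norm_apply_le (x : C₀(ℕ, 𝕜)) (n : ℕ) : ‖x n‖ ≤ ‖x‖ := by
  rw [← ZeroAtInftyContinuousMap.norm_toBCF_eq_norm]
  exact x.toBCF.norm_coe_le_norm n

theorem C0.norm_le {x : C₀(ℕ, 𝕜)} {c : ℝ} (hc : 0 ≤ c) (h : ∀ n, ‖x n‖ ≤ c) : ‖x‖ ≤ c := by
  rw [← ZeroAtInftyContinuousMap.norm_toBCF_eq_norm]
  exact (BoundedContinuousFunction.norm_le hc).2 h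

/-- A null sequence as an element of `c_0`. -/
def C0.mk (f : ℕ → 𝕜) (hf : Tendsto f atTop (nhds 0)) : C₀(ℕ, 𝕜) where
  toFun := f
  continuous_toFun := continuous_of_discreteTopology
  zero_at_infty' := by rwa [cocompact_eq_cofinite, Nat.cofinite_eq_atTop]

theorem C0.tendsto (x : C₀(ℕ, 𝕜)) : Tendsto x atTop (nhds 0) := by
  have h := x.zero_at_infty'
  rwa [cocompact_eq_cofinite, Nat.cofinite_eq_atTop] at h

/-- The coordinate functionals of `c_0`. -/
def C0.coord (n : ℕ) : C₀(ℕ, 𝕜) →ₗ[𝕜] 𝕜 where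
  toFun x := x n
  map_add' _ _ := rfl
  map_smul' _ _ := rfl

/-- The unit vectors of `c_0`. -/
def C0.single (n : ℕ) : C₀(ℕ, 𝕜) :=
  C0.mk (Pi.single n 1) <| tendsto_const_nhds.congr' <| by
    filter_upwards [eventually_gt_atTop n] with k hk
    exact (Pi.single_eq_of_ne (M := fun _ : ℕ => 𝕜) hk.ne' 1).symm

theorem norm_c0BackwardShift_le (x : C₀(ℕ, 𝕜)) : ‖c0BackwardShift 𝕜 x‖ ≤ ‖x‖ :=
  C0.norm_le (norm_nonneg x) fun n => C0.norm_apply_le x (n + 1)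

theorem exists_c0BackwardShift_eq (x : C₀(ℕ, 𝕜)) :
    ∃ y, c0BackwardShift 𝕜 y = x ∧ ‖y‖ ≤ ‖x‖ := by
  refine ⟨C0.mk (prependZero x) ((tendsto_add_atTop_iff_nat 1).1 (C0.tendsto x)), rfl,
    C0.norm_le (norm_nonneg x) fun n => ?_⟩
  cases n with
  | zero => exact norm_zero.trans_le (norm_nonneg x)
  | succ n => exact C0.norm_apply_le x n

theorem c0BackwardShift_pow_apply (k : ℕ) (x : C₀(ℕ, 𝕜)) (n : ℕ) :
    (c0BackwardShift 𝕜 ^ k) x n = x (n + k) := by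
  induction k generalizing x with
  | zero => rfl
  | succ k ih =>
    rw [pow_succ, mul_apply_eq_comp, ih]
    rfl

theorem dense_span_C0_single :
    Dense (Submodule.span 𝕜 (range (C0.single (𝕜 := 𝕜))) : Set C₀(ℕ, 𝕜)) := by
  intro x
  refine Metric.mem_closure_iff.2 fun ε hε => ?_
  obtain ⟨M, hM⟩ := Metric.tendsto_atTop.1 (C0.tendsto x) (ε / 2) (by positivity)
  refine ⟨∑ k ∈ Finset.range M, x k • C0.single k, Submodule.sum_mem _ fun n _ =>
    Submodule.smul_mem _ _ (Submodule.subset_span (mem_range_self n)), ?_⟩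
  rw [dist_eq_norm]
  -- A supremum of strict bounds need not be strict, hence `ε / 2`.
  refine lt_of_le_of_lt (C0.norm_le (c := ε / 2) (by positivity) fun n => ?_) (half_lt_self hε)
  have h1 : (∑ k ∈ Finset.range M, x k • C0.single (𝕜 := 𝕜) k) n =
      if n < M then x n else 0 := by
    change C0.coord n (∑ k ∈ Finset.range M, x k • C0.single (𝕜 := 𝕜) k) = _
    rw [map_sum]
    have h2 : ∀ k, C0.coord n (x k • C0.single (𝕜 := 𝕜) k) = if n = k then x k else 0 := by
      intro k
      change x k * (Pi.single k (1 : 𝕜) : ℕ → 𝕜) n = _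
      rw [Pi.single_apply]
      simp
    simp only [h2, Finset.sum_ite_eq, Finset.mem_range]
  rw [ZeroAtInftyContinuousMap.sub_apply, h1]
  split_ifs with h
  · rw [sub_self, norm_zero]
    positivity
  · rw [← dist_eq_norm]
    exact (hM n (not_lt.1 h)).le

end C0

end

theorem mainTheorem6 {𝕜 : Type*} [RCLike 𝕜] (N : ℕ) (hN : 2 ≤ N)
    (lam : Fin N → 𝕜) (i : Fin N → ℕ)
    (hlam : ∀ s, 1 < ‖lam s‖) (hmono : ∀ s t, s ≤ t → ‖lam s‖ ≤ ‖lam t‖)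
    (hi : ∀ s, 1 ≤ i s) :
    (∀ (p : ℝ≥0∞) [Fact (1 ≤ p)], p ≠ ∞ →
      List.TFAE [
        DisjointFrequentlyHypercyclic (fun s => lam s • lpBackwardShift 𝕜 p ^ i s),
        DisjointUpperFrequentlyHypercyclic (fun s => lam s • lpBackwardShift 𝕜 p ^ i s),
        DisjointReiterativelyHypercyclic (fun s => lam s • lpBackwardShift 𝕜 p ^ i s),
        DisjointHypercyclic (fun s => lam s • lpBackwardShift 𝕜 p ^ i s),
        ∀ s t, s < t → i s < i t ∧ ‖lam s‖ < ‖lam t‖]) ∧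
    List.TFAE [
      DisjointFrequentlyHypercyclic (fun s => lam s • c0BackwardShift 𝕜 ^ i s),
      DisjointUpperFrequentlyHypercyclic (fun s => lam s • c0BackwardShift 𝕜 ^ i s),
      DisjointReiterativelyHypercyclic (fun s => lam s • c0BackwardShift 𝕜 ^ i s),
      DisjointHypercyclic (fun s => lam s • c0BackwardShift 𝕜 ^ i s),
      ∀ s t, s < t → i s < i t ∧ ‖lam s‖ < ‖lam t‖] := by
  refine ⟨fun p _ hp => ?_, ?_⟩
  · choose S hBS hS using exists_lpBackwardShift_eq (𝕜 := 𝕜) hp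
    refine tfae_disjointHypercyclic (e := fun n => lp.single p n (1 : 𝕜))
      (φ := { toFun := fun x => x 0, map_add' := fun _ _ => rfl, map_smul' := fun _ _ => rfl })
      norm_lpBackwardShift_le hS hBS (dense_span_lp_single hp) (fun n => ?_) (fun x => ?_) ?_
      hlam hmono hi
    · ext k
      rw [lpBackwardShift_pow_apply]
      exact lp.single_apply_ne (E := fun _ : ℕ => 𝕜) p n (1 : 𝕜) (by omega : k + (n + 1) ≠ n)
    · exact lp.norm_apply_le_norm (zero_lt_one.trans_le Fact.out).ne' x 0
    · exact lp.single_apply_self (E := fun _ : ℕ => 𝕜) p 0 (1 : 𝕜)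
  · choose S hBS hS using exists_c0BackwardShift_eq (𝕜 := 𝕜)
    refine tfae_disjointHypercyclic (φ := C0.coord 0) norm_c0BackwardShift_le hS hBS
      dense_span_C0_single (fun n => ?_) (fun x => C0.norm_apply_le x 0) ?_ hlam hmono hi
    · ext k
      rw [c0BackwardShift_pow_apply]
      exact Pi.single_eq_of_ne (M := fun _ : ℕ => 𝕜) (by omega : k + (n + 1) ≠ n) 1
    · exact Pi.single_eq_same (M := fun _ : ℕ => 𝕜) 0 1
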